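/- Let $\Sigma$ be an alphabet and $M$ an operator precedence matrix on $\Sigma\cup\{\#\}$, i.e. a map assigning to each ordered pair of symbols at most one of the relations $\lessdot,\doteq,\gtrdot$, where always $\#\lessdot a$ and $a\gtrdot\#$ for $a\in\Sigma$. For a word $w=a_1\cdots a_n$ over $\Sigma$, with $a_0=a_{n+1}=\#$, the chain relation $i\curvearrowright j$ on $\{0,\dots,n+1\}$ is defined inductively: $i\curvearrowright j$ if there are positions $i=k_1<\dots<k_m=j$ with $a_{k_1}\lessdot a_{k_2}\doteq\cdots\doteq a_{k_{m-1}}\gtrdot a_{k_m}$ and, for each $s<m$, $k_s+1=k_{s+1}$ or $k_s\curvearrowright k_{s+1}$. Let $(\Sigma,M)^+$ be the set of nonempty words $w$ over $\Sigma$ with $0\curvearrowright |w|+1$. An operator precedence automaton (OPA) $(Q,I,F,\delta)$ over $(\Sigma,M)$ consists of a finite set $Q$ of states, sets $I,F\subseteq Q$, and transition relations $\delta_{\mathrm{shift}},\delta_{\mathrm{push}}\subseteq Q\times\Sigma\times Q$ and $\delta_{\mathrm{pop}}\subseteq Q\times Q\times Q$. Its configurations $\langle\Pi,q,x\#\rangle$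 consist of a stack $\Pi\in\bot(\Sigma\times Q)^*$, a state $q$ and a remaining input $x$. Its moves are \begin{align*} \langle\Pi,q,bx\rangle&\vdash\langle\Pi[b,q],r,x\rangle &&\text{if } a\lessdot b \text{ and } (q,b,r)\in\delta_{\mathrm{push}}, \text{ where } a \text{ is the topmost symbol of }\Pi \ (\# \text{ for } \Pi=\bot),\\ \langle\Pi[a,p],q,bx\rangle&\vdash\langle\Pi[b,p],r,x\rangle &&\text{if } a\doteq b \text{ and } (q,b,r)\in\delta_{\mathrm{shift}},\\ \langle\Pi[a,p],q,bx\rangle&\vdash\langle\Pi,r,bx\rangle &&\text{if } a\gtrdot b \text{ and } (q,p,r)\in\delta_{\mathrm{pop}} \ (b=\# \text{ allowed}). \end{align*} An accepting run on $w$ is a finite sequence of moves from $\langle\bot,q_I,w\#\rangle$ to $\langle\bot,q_F,\#\rangle$ for some $q_I\in I$, $q_F\in F$. A set $L\subseteq(\Sigma,M)^+$ is an operator precedence language (OPL) if, for some OPA, $L$ is the set of words in $(\Sigma,M)^+$ that have an accepting run. A weighted OPA over $(\Sigma,M)$ and a semiring $\mathbb K=(K,+,\cdot,0,1)$ is an OPA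 with weight functions $\mathrm{wt}_{op}:\delta_{op}\to K$ for $op\in\{\mathrm{shift},\mathrm{push},\mathrm{pop}\}$; it is restricted if $\mathrm{wt}_{\mathrm{pop}}\equiv1$. The weight of a run is the product, in the order of the run, of the weights of its transitions. The behavior of a weighted OPA is the series $(\Sigma,M)^+\to K$ that maps $w$ to the (finite) sum of the weights of all accepting runs on $w$. A series $S:(\Sigma,M)^+\to K$ is regular (resp. strictly regular) if it is the behavior of a weighted OPA (resp. of a restricted weighted OPA). Let $S:(\Sigma,M)^+\to K$ be a regular (resp. strictly regular) series and let $L\subseteq(\Sigma,M)^+$ be an OPL. Then the series $S\cap L$ given by $(S\cap L)(w)=S(w)$ if $w\in L$ and $(S\cap L)(w)=0$ otherwise is regular (resp. strictly regular). Furthermore, if $\mathbb K$ is commutative and $S,T:(\Sigma,M)^+\to K$ are regular (resp. strictly regular), then the pointwise product $(S\odot T)(w)=S(w)\cdot T(w)$ is regular (resp. strictly regular). -/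

import Mathlib

/-- The three operator precedence relations: `⋖`, `≐` and `⋗`. -/
inductive OPRel : Type
  | yields : OPRel
  | equal : OPRel
  | takes : OPRel

/-- An operator precedence matrix over the alphabet `A`. Each entry is one of the three relations
or empty (`none`). The entries for the end marker `#` are always the same and are added by
`OPM.rel`. -/
def OPM (A : Type*) : Type _ := A → A → Option OPRel

/-- The precedence relation between two symbols of `A ∪ {#}`, where `none` stands for `#`:
always `# ⋖ a` and `a ⋗ #`. -/
def OPM.rel {A : Type*} (M : OPM A) : Option A → Option A → Option OPRel
  | some a, some b => M a b
  | none, some _ => some OPRel.yields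
  | some _, none => some OPRel.takes
  | none, none => none

/-- The symbol of `# w #` at position `i`, where `0 ≤ i ≤ |w| + 1` and `none` stands for `#`. -/
def markedAt {A : Type*} (w : List A) : ℕ → Option A
  | 0 => none
  | i + 1 => w[i]?

/-- The chain relation `i ↷ j` on the positions of `# w #`: there are positions
`i = k 1 < ... < k m = j` with `a_{k 1} ⋖ a_{k 2} ≐ ... ≐ a_{k (m-1)} ⋗ a_{k m}` such that any two
consecutive ones are adjacent or again in the chain relation.
Only the values `k 1, ..., k m` matter. -/
inductive OPM.Chain {A : Type*} (M : OPM A) (w : List A) : ℕ → ℕ → Prop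
  | intro (m : ℕ) (hm : 3 ≤ m) (k : ℕ → ℕ)
      (hlt : ∀ s, 1 ≤ s → s < m → k s < k (s + 1))
      (hend : k m ≤ w.length + 1)
      (hyields : M.rel (markedAt w (k 1)) (markedAt w (k 2)) = some OPRel.yields)
      (hequal : ∀ s, 2 ≤ s → s + 1 < m →
        M.rel (markedAt w (k s)) (markedAt w (k (s + 1))) = some OPRel.equal)
      (htakes : M.rel (markedAt w (k (m - 1))) (markedAt w (k m)) = some OPRel.takes)
      (hlink : ∀ s, 1 ≤ s → s < m → ¬ (k s + 1 = k (s + 1)) → OPM.Chain M w (k s) (k (s + 1))) :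
      OPM.Chain M w (k 1) (k m)

/-- `w` is compatible with `M` if `0 ↷ |w| + 1`. -/
def OPM.Compatible {A : Type*} (M : OPM A) (w : List A) : Prop :=
  M.Chain w 0 (w.length + 1)

/-- `(A, M)⁺`: the nonempty words over `A` that are compatible with `M`. -/
def OPWord {A : Type*} (M : OPM A) : Type _ :=
  {w : List A // w ≠ [] ∧ M.Compatible w}

/-- An operator precedence automaton over `(A, M)` with state set `Q`. Finiteness of `Q` is
demanded where automata are used. -/
structure OPA {A : Type*} (M : OPM A) (Q : Type*) where
  init : Set Q
  final : Set Q
  shift : Set (Q × A × Q)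
  push : Set (Q × A × Q)
  pop : Set (Q × Q × Q)

/-- A configuration: the stack (topmost element first; the bottom symbol `⊥` is not
listed), the current state, and the remaining input (without the final `#`). -/
structure OPConfig (A Q : Type*) where
  stack : List (A × Q)
  state : Q
  input : List A

/-- The topmost alphabet symbol of a stack, which is `#` (`none`) for the stack `⊥`. -/
def topSymbol {A Q : Type*} (st : List (A × Q)) : Option A := st.head?.map Prod.fst

/-- The moves of an automaton. In a pop move, the next symbol `x.head?` is `#` (`none`) if the
input has been read completely. -/
inductive OPA.Step {A Q : Type*} {M : OPM A} (𝓐 : OPA M Q) :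
    OPConfig A Q → OPConfig A Q → Prop
  | push (st : List (A × Q)) (q r : Q) (b : A) (x : List A)
      (hrel : M.rel (topSymbol st) (some b) = some OPRel.yields) (h : (q, b, r) ∈ 𝓐.push) :
      OPA.Step 𝓐 ⟨st, q, b :: x⟩ ⟨(b, q) :: st, r, x⟩
  | shift (st : List (A × Q)) (p q r : Q) (a b : A) (x : List A)
      (hrel : M.rel (some a) (some b) = some OPRel.equal) (h : (q, b, r) ∈ 𝓐.shift) :
      OPA.Step 𝓐 ⟨(a, p) :: st, q, b :: x⟩ ⟨(b, p) :: st, r, x⟩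
  | pop (st : List (A × Q)) (p q r : Q) (a : A) (x : List A)
      (hrel : M.rel (some a) x.head? = some OPRel.takes) (h : (q, p, r) ∈ 𝓐.pop) :
      OPA.Step 𝓐 ⟨(a, p) :: st, q, x⟩ ⟨st, r, x⟩

/-- The accepting runs on `w`: the finite sequences of configurations, each leading to the next one
by a move, from `⟨⊥, q, w#⟩` with `q` initial to `⟨⊥, q', #⟩` with `q'` final. -/
def OPA.acceptingRuns {A Q : Type*} {M : OPM A} (𝓐 : OPA M Q) (w : List A) :
    Set (List (OPConfig A Q)) :=
  {ρ | ρ.IsChain 𝓐.Step ∧ (∃ q ∈ 𝓐.init, ρ.head? = some ⟨[], q, w⟩) ∧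
    ∃ q ∈ 𝓐.final, ρ.getLast? = some ⟨[], q, []⟩}

/-- The language accepted by an automaton: the words of `(A, M)⁺` that have an accepting run. -/
def OPA.language {A Q : Type*} {M : OPM A} (𝓐 : OPA M Q) : Set (OPWord M) :=
  {w | (𝓐.acceptingRuns w.1).Nonempty}

/-- `L` is an operator precedence language. (Up to renaming of states, every finite state set
lives in `Type`.) -/
def IsOPL {A : Type*} {M : OPM A} (L : Set (OPWord M)) : Prop :=
  ∃ (Q : Type) (_ : Finite Q) (𝓐 : OPA M Q), 𝓐.language = L

/-- A weighted operator precedence automaton: an automaton with a weight for every transition. -/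
structure WOPA {A : Type*} (M : OPM A) (K Q : Type*) extends OPA M Q where
  wtShift : shift → K
  wtPush : push → K
  wtPop : pop → K

/-- Restricted automata: all weights of pop transitions are `1`. -/
def WOPA.Restricted {A K Q : Type*} [Semiring K] {M : OPM A} (𝓐 : WOPA M K Q) : Prop :=
  ∀ t : 𝓐.pop, 𝓐.wtPop t = 1

/-- A configuration of a weighted automaton. -/
structure WOPConfig (A K Q : Type*) extends OPConfig A Q where
  weight : K

/-- The moves of a weighted automaton, which multiply the weight from the right by the weight of the
transition. -/
inductive WOPA.Step {A K Q : Type*} [Semiring K] {M : OPM A} (𝓐 : WOPA M K Q) :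
    WOPConfig A K Q → WOPConfig A K Q → Prop
  | push (st : List (A × Q)) (q r : Q) (b : A) (x : List A) (k : K)
      (hrel : M.rel (topSymbol st) (some b) = some OPRel.yields) (h : (q, b, r) ∈ 𝓐.push) :
      WOPA.Step 𝓐 ⟨⟨st, q, b :: x⟩, k⟩ ⟨⟨(b, q) :: st, r, x⟩, k * 𝓐.wtPush ⟨(q, b, r), h⟩⟩
  | shift (st : List (A × Q)) (p q r : Q) (a b : A) (x : List A) (k : K)
      (hrel : M.rel (some a) (some b) = some OPRel.equal) (h : (q, b, r) ∈ 𝓐.shift) :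
      WOPA.Step 𝓐 ⟨⟨(a, p) :: st, q, b :: x⟩, k⟩
        ⟨⟨(b, p) :: st, r, x⟩, k * 𝓐.wtShift ⟨(q, b, r), h⟩⟩
  | pop (st : List (A × Q)) (p q r : Q) (a : A) (x : List A) (k : K)
      (hrel : M.rel (some a) x.head? = some OPRel.takes) (h : (q, p, r) ∈ 𝓐.pop) :
      WOPA.Step 𝓐 ⟨⟨(a, p) :: st, q, x⟩, k⟩ ⟨⟨st, r, x⟩, k * 𝓐.wtPop ⟨(q, p, r), h⟩⟩

/-- The accepting runs on `w`: from `⟨⊥, q, w#, 1⟩` with `q` initial to `⟨⊥, q', #, k⟩` with `q'`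
final and `k` arbitrary. -/
def WOPA.acceptingRuns {A K Q : Type*} [Semiring K] {M : OPM A} (𝓐 : WOPA M K Q) (w : List A) :
    Set (List (WOPConfig A K Q)) :=
  {ρ | ρ.IsChain 𝓐.Step ∧ (∃ q ∈ 𝓐.init, ρ.head? = some ⟨⟨[], q, w⟩, 1⟩) ∧
    ∃ q ∈ 𝓐.final, ∃ k : K, ρ.getLast? = some ⟨⟨[], q, []⟩, k⟩}

/-- The weight of a run: the weight of its last configuration (`0` for the empty
sequence, which is not a run). -/
def runWeight {A K Q : Type*} [Semiring K] (ρ : List (WOPConfig A K Q)) : K :=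
  (ρ.getLast?.map WOPConfig.weight).getD 0

theorem WOPA.finite_successors {A K Q : Type*} [Semiring K] {M : OPM A} [Finite Q]
    (𝓐 : WOPA M K Q) (C : WOPConfig A K Q) : {C' | 𝓐.Step C C'}.Finite := by
  refine Set.Finite.of_finite_image (f := fun C' => C'.state) (Set.toFinite _) ?_
  rintro C₁ h₁ C₂ h₂ heq
  simp only [Set.mem_ofPred_eq] at h₁ h₂
  cases h₁ <;> cases h₂ <;> simp_all [topSymbol]

/-- There are only finitely many runs from a given configuration. -/
theorem WOPA.finite_runsFrom {A K Q : Type*} [Semiring K] {M : OPM A} [Finite Q]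
    (𝓐 : WOPA M K Q) (n : ℕ) : ∀ C : WOPConfig A K Q,
      2 * C.input.length + C.stack.length ≤ n →
      {ρ : List (WOPConfig A K Q) | ρ.IsChain 𝓐.Step ∧ ρ.head? = some C}.Finite := by
  induction n with
  | zero =>
    intro C hC
    refine (Set.finite_singleton [C]).subset ?_
    rintro ρ ⟨hρ, hh⟩
    match ρ, hρ, hh with
    | [D], _, hh => simpa using hh
    | D :: E :: t, hρ, hh =>
      obtain rfl : D = C := by simpa using hh
      have hs := (List.isChain_cons_cons.1 hρ).1
      cases hs <;> simp at hC
  | succ n ih =>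
    intro C hC
    have hfin : (⋃ C' ∈ {C' | 𝓐.Step C C'}, (fun ρ => C :: ρ) ''
        {ρ : List (WOPConfig A K Q) | ρ.IsChain 𝓐.Step ∧ ρ.head? = some C'}).Finite := by
      refine (𝓐.finite_successors C).biUnion fun C' hs => Set.Finite.image _ (ih C' ?_)
      simp only [Set.mem_ofPred_eq] at hs
      cases hs <;> simp at hC ⊢ <;> omega
    refine ((Set.finite_singleton [C]).union hfin).subset ?_
    rintro ρ ⟨hρ, hh⟩
    match ρ, hρ, hh with
    | [D], _, hh => left; simpa using hh
    | D :: E :: t, hρ, hh =>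
      obtain rfl : D = C := by simpa using hh
      obtain ⟨hs, ht⟩ := List.isChain_cons_cons.1 hρ
      right
      simp only [Set.mem_iUnion]
      exact ⟨E, hs, E :: t, ⟨ht, rfl⟩, rfl⟩

/-- The sum in the definition of the behavior is a finite sum. -/
theorem WOPA.finite_acceptingRuns {A K Q : Type*} [Semiring K] {M : OPM A} [Finite Q]
    (𝓐 : WOPA M K Q) (w : List A) : (𝓐.acceptingRuns w).Finite := by
  have h : (⋃ q : Q, {ρ : List (WOPConfig A K Q) | ρ.IsChain 𝓐.Step ∧
      ρ.head? = some ⟨⟨[], q, w⟩, 1⟩}).Finite :=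
    Set.finite_iUnion fun q => 𝓐.finite_runsFrom _ _ le_rfl
  refine h.subset ?_
  rintro ρ ⟨hρ, ⟨q, _, hq⟩, _⟩
  exact Set.mem_iUnion.2 ⟨q, hρ, hq⟩

/-- The behavior of a weighted automaton with finitely many states: the sum of the weights of all
accepting runs. -/
noncomputable def WOPA.behavior {A K Q : Type*} [Semiring K] {M : OPM A} [Finite Q]
    (𝓐 : WOPA M K Q) : OPWord M → K :=
  fun w => ∑ ρ ∈ (𝓐.finite_acceptingRuns w.1).toFinset, runWeight ρ

/-- A series is regular if it is the behavior of a weighted automaton. -/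
def IsRegularSeries {A K : Type*} [Semiring K] {M : OPM A} (S : OPWord M → K) : Prop :=
  ∃ (Q : Type) (_ : Finite Q) (𝓐 : WOPA M K Q), 𝓐.behavior = S

/-- A series is strictly regular if it is the behavior of a restricted weighted automaton. -/
def IsStrictlyRegularSeries {A K : Type*} [Semiring K] {M : OPM A} (S : OPWord M → K) : Prop :=
  ∃ (Q : Type) (_ : Finite Q) (𝓐 : WOPA M K Q), 𝓐.Restricted ∧ 𝓐.behavior = S

open Classical in
/-- The restriction `S ∩ L` of a series `S` to a language `L`. -/
noncomputable def seriesRestrict {A K : Type*} [Semiring K] {M : OPM A} (S : OPWord M → K)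
    (L : Set (OPWord M)) : OPWord M → K :=
  fun w => if w ∈ L then S w else 0

/-- The pointwise product `S ⊙ T` of two series. -/
def seriesProd {A K : Type*} [Semiring K] {M : OPM A} (S T : OPWord M → K) : OPWord M → K :=
  fun w => S w * T w

/-! The matrix assigns at most one relation to a pair of symbols, so the topmost stack symbol and
the next input symbol decide whether a push, a shift or a pop is possible; the states have no
influence. Two automata reading the same word therefore move in lockstep and their stacks carry the
same symbols, so a product automaton can simulate both, storing pairs of states on one stack.

To avoid bijections between sets of runs, the behavior is rewritten as a recursion on
configurations, `completionWeight` (`WOPA.behavior_eq_sum`). For the product automaton this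
recursion factors, provided that the weights of the second factor are central
(`WOPA.completionWeight_prod`). If the semiring is commutative, this gives the statement about `S ⊙
T`.

For `S ∩ L` the semiring is arbitrary, but the second factor can be chosen with all weights `1`,
which are central. It must also have exactly one accepting run on each word of `L`, as otherwise `S
w` would be multiplied by a number of runs. So the automaton for `L` is determinized by a subset
construction, and its behavior is the characteristic series of `L` (`OPA.determinize_behavior`).
Restrictedness survives because `1 * 1 = 1`. -/

/-! ### A recursion for the total weight of the completions of a configuration -/

open Classical in
/-- The weight of a push transition, which is `0` for a triple that is not a transition. -/
noncomputable def WOPA.pushWeight {A K Q : Type*} [Semiring K] {M : OPM A} (𝓐 : WOPA M K Q)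
    (q : Q) (b : A) (r : Q) : K :=
  if h : (q, b, r) ∈ 𝓐.push then 𝓐.wtPush ⟨(q, b, r), h⟩ else 0

open Classical in
/-- The weight of a shift transition, which is `0` for a triple that is not a transition. -/
noncomputable def WOPA.shiftWeight {A K Q : Type*} [Semiring K] {M : OPM A} (𝓐 : WOPA M K Q)
    (q : Q) (b : A) (r : Q) : K :=
  if h : (q, b, r) ∈ 𝓐.shift then 𝓐.wtShift ⟨(q, b, r), h⟩ else 0

open Classical in
/-- The weight of a pop transition, which is `0` for a triple that is not a transition. -/
noncomputable def WOPA.popWeight {A K Q : Type*} [Semiring K] {M : OPM A} (𝓐 : WOPA M K Q)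
    (q p r : Q) : K :=
  if h : (q, p, r) ∈ 𝓐.pop then 𝓐.wtPop ⟨(q, p, r), h⟩ else 0

open Classical in
/-- The sum of the weights of all runs with fewer than `n` moves from a configuration to an
accepting one. -/
noncomputable def WOPA.completionWeight {A K Q : Type*} [Semiring K] {M : OPM A} [Fintype Q]
    (𝓐 : WOPA M K Q) : ℕ → List (A × Q) → Q → List A → K
  | 0, _, _, _ => 0
  | n + 1, st, q, x =>
    match M.rel (topSymbol st) x.head? with
    -- Either `#` meets `#` and the run may end here, or the matrix entry is empty and the run is
    -- stuck. The `0` branches for an empty stack or input below never occur, since `#` never takes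
    -- part in the relation concerned on that side.
    | none => if st = [] ∧ x = [] ∧ q ∈ 𝓐.final then 1 else 0
    | some OPRel.yields =>
      match x with
      | [] => 0
      | b :: x => ∑ r, 𝓐.pushWeight q b r * 𝓐.completionWeight n ((b, q) :: st) r x
    | some OPRel.equal =>
      match st with
      | [] => 0
      | (_, p) :: st =>
        match x with
        | [] => 0
        | b :: x => ∑ r, 𝓐.shiftWeight q b r * 𝓐.completionWeight n ((b, p) :: st) r x
    | some OPRel.takes =>
      match st with
      | (_, p) :: st => ∑ r, 𝓐.popWeight q p r * 𝓐.completionWeight n st r x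
      | [] => 0

section CompletionWeight

variable {A K Q : Type*} [Semiring K] {M : OPM A} [Fintype Q] (𝓐 : WOPA M K Q)

open Classical in
theorem WOPA.completionWeight_none (n : ℕ) {st : List (A × Q)} {q : Q} {x : List A}
    (hrel : M.rel (topSymbol st) x.head? = none) :
    𝓐.completionWeight (n + 1) st q x = if st = [] ∧ x = [] ∧ q ∈ 𝓐.final then 1 else 0 := by
  rw [WOPA.completionWeight.eq_def]
  simp only [hrel]

theorem WOPA.completionWeight_yields (n : ℕ) {st : List (A × Q)} {q : Q} {b : A} {x : List A}
    (hrel : M.rel (topSymbol st) (some b) = some OPRel.yields) :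
    𝓐.completionWeight (n + 1) st q (b :: x) =
      ∑ r, 𝓐.pushWeight q b r * 𝓐.completionWeight n ((b, q) :: st) r x := by
  rw [WOPA.completionWeight.eq_def]
  simp only [List.head?_cons, hrel]

theorem WOPA.completionWeight_equal (n : ℕ) {st : List (A × Q)} {p q : Q} {a b : A} {x : List A}
    (hrel : M.rel (some a) (some b) = some OPRel.equal) :
    𝓐.completionWeight (n + 1) ((a, p) :: st) q (b :: x) =
      ∑ r, 𝓐.shiftWeight q b r * 𝓐.completionWeight n ((b, p) :: st) r x := by
  rw [WOPA.completionWeight.eq_def]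
  simp only [topSymbol, List.head?_cons, Option.map_some, hrel]

theorem WOPA.completionWeight_takes (n : ℕ) {st : List (A × Q)} {p q : Q} {a : A} {x : List A}
    (hrel : M.rel (some a) x.head? = some OPRel.takes) :
    𝓐.completionWeight (n + 1) ((a, p) :: st) q x =
      ∑ r, 𝓐.popWeight q p r * 𝓐.completionWeight n st r x := by
  rw [WOPA.completionWeight.eq_def]
  simp only [topSymbol, List.head?_cons, Option.map_some, hrel]

end CompletionWeight

/-- Either no precedence relation holds between the topmost symbol and the next one, or the stack
and the input have the shape that the move for the relation requires. -/
theorem OPM.rel_cases {A Q : Type*} (M : OPM A) (st : List (A × Q)) (x : List A) :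
    M.rel (topSymbol st) x.head? = none ∨
    (∃ b y, x = b :: y ∧ M.rel (topSymbol st) (some b) = some OPRel.yields) ∨
    (∃ a p st' b y, st = (a, p) :: st' ∧ x = b :: y ∧
      M.rel (some a) (some b) = some OPRel.equal) ∨
    (∃ a p st', st = (a, p) :: st' ∧ M.rel (some a) x.head? = some OPRel.takes) := by
  rcases hrel : M.rel (topSymbol st) x.head? with _ | _ | _ | _ <;>
    rcases st with _ | ⟨⟨a, p⟩, st⟩ <;> rcases x with _ | ⟨b, x⟩ <;>
    simp_all [topSymbol, OPM.rel]

/-! ### Sums over runs satisfy the recursion -/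

/-- The runs from a configuration to an accepting one. -/
def WOPA.runsToFinal {A K Q : Type*} [Semiring K] {M : OPM A} (𝓐 : WOPA M K Q)
    (C : WOPConfig A K Q) : Set (List (WOPConfig A K Q)) :=
  {ρ | ρ.IsChain 𝓐.Step ∧ ρ.head? = some C ∧
    ∃ q ∈ 𝓐.final, ∃ k : K, ρ.getLast? = some ⟨⟨[], q, []⟩, k⟩}

section Runs

variable {A K Q : Type*} [Semiring K] {M : OPM A} (𝓐 : WOPA M K Q)

theorem WOPA.finite_runsToFinal [Finite Q] (C : WOPConfig A K Q) : (𝓐.runsToFinal C).Finite :=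
  (𝓐.finite_runsFrom _ C le_rfl).subset fun _ h => ⟨h.1, h.2.1⟩

/-- The hypothesis rules out the run consisting of `C` alone, so every run has a first move to split
off. -/
theorem WOPA.runsToFinal_eq_biUnion {C : WOPConfig A K Q}
    (hC : ¬ (C.stack = [] ∧ C.input = [] ∧ C.state ∈ 𝓐.final)) :
    𝓐.runsToFinal C = ⋃ C' ∈ {C' | 𝓐.Step C C'}, (fun ρ => C :: ρ) '' 𝓐.runsToFinal C' := by
  ext ρ
  simp only [Set.mem_iUnion, Set.mem_image, exists_prop]
  constructor
  · rintro ⟨h₁, h₂, q, hq, k, h₃⟩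
    match ρ, h₁, h₂, h₃ with
    | [D], _, h₂, h₃ =>
      obtain rfl : D = C := by simpa using h₂
      obtain rfl : D = _ := by simpa using h₃
      exact absurd ⟨rfl, rfl, hq⟩ hC
    | D :: E :: t, h₁, h₂, h₃ =>
      obtain rfl : D = C := by simpa using h₂
      obtain ⟨hs, ht⟩ := List.isChain_cons_cons.1 h₁
      exact ⟨E, hs, E :: t, ⟨ht, rfl, q, hq, k, by simpa [List.getLast?_cons_cons] using h₃⟩, rfl⟩
  · rintro ⟨C', hs, τ, ⟨h₁, h₂, q, hq, k, h₃⟩, rfl⟩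
    match τ, h₁, h₂, h₃ with
    | E :: t, h₁, h₂, h₃ =>
      obtain rfl : E = C' := by simpa using h₂
      exact ⟨List.isChain_cons_cons.2 ⟨hs, h₁⟩, rfl, q, hq, k,
        by simpa [List.getLast?_cons_cons] using h₃⟩

theorem runWeight_cons (C : WOPConfig A K Q) {ρ : List (WOPConfig A K Q)} (h : ρ ≠ []) :
    runWeight (C :: ρ) = runWeight ρ := by
  cases ρ with
  | nil => exact absurd rfl h
  | cons D t => simp [runWeight, List.getLast?_cons_cons]

theorem WOPA.ne_nil_of_mem_runsToFinal {C : WOPConfig A K Q} {ρ : List (WOPConfig A K Q)}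
    (h : ρ ∈ 𝓐.runsToFinal C) : ρ ≠ [] := by
  rintro rfl
  simpa using h.2.1

/-- The second configuration can be read off a run, so the union is disjoint; prepending `C` keeps
the weight, which sits in the last configuration. -/
theorem WOPA.finsum_runsToFinal [Finite Q] {C : WOPConfig A K Q}
    (hC : ¬ (C.stack = [] ∧ C.input = [] ∧ C.state ∈ 𝓐.final)) :
    ∑ᶠ ρ ∈ 𝓐.runsToFinal C, runWeight ρ =
      ∑ᶠ C' ∈ {C' | 𝓐.Step C C'}, ∑ᶠ ρ ∈ 𝓐.runsToFinal C', runWeight ρ := by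
  rw [𝓐.runsToFinal_eq_biUnion hC, finsum_mem_biUnion]
  · refine finsum_mem_congr rfl fun C' _ => ?_
    rw [finsum_mem_image (List.cons_injective.injOn)]
    exact finsum_mem_congr rfl fun ρ hρ => runWeight_cons C (𝓐.ne_nil_of_mem_runsToFinal hρ)
  · rintro C₁ - C₂ - hne
    refine Set.disjoint_left.2 ?_
    rintro _ ⟨ρ, h₁, rfl⟩ ⟨τ, h₂, he⟩
    obtain rfl : τ = ρ := by simpa using he
    exact hne (Option.some_injective _ (h₁.2.1.symm.trans h₂.2.1))
  · exact 𝓐.finite_successors C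
  · exact fun C' _ => (𝓐.finite_runsToFinal C').image _

/-- Turns a sum over successor configurations into one over all target states, where non-transitions
contribute `0`. -/
theorem finsum_mem_image_eq_sum {β : Type*} [Fintype Q] {s : Set β} (T : Set Q) (f : Q → β)
    (hf : Function.Injective f) (hs : s = f '' T) (g : β → K) (g' : Q → K)
    (h : ∀ r ∈ T, g (f r) = g' r) (h0 : ∀ r ∉ T, g' r = 0) :
    ∑ᶠ y ∈ s, g y = ∑ r, g' r := by
  subst hs
  rw [finsum_mem_image hf.injOn, finsum_mem_congr rfl h, ← finsum_eq_sum_of_fintype]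
  refine finsum_congr fun r => ?_
  by_cases hr : r ∈ T
  · simp [hr]
  · simp [hr, h0 r hr]

theorem WOPA.setOf_step_push {st : List (A × Q)} {q : Q} {b : A} {x : List A} {k : K}
    (hrel : M.rel (topSymbol st) (some b) = some OPRel.yields) :
    {C' | 𝓐.Step ⟨⟨st, q, b :: x⟩, k⟩ C'} =
      (fun r => ⟨⟨(b, q) :: st, r, x⟩, k * 𝓐.pushWeight q b r⟩) '' {r | (q, b, r) ∈ 𝓐.push} := by
  ext C'
  constructor
  · intro h
    cases h with
    | push _ _ r _ _ _ _ h => exact ⟨r, h, by simp [WOPA.pushWeight, dif_pos h]⟩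
    | shift _ p _ r a _ _ _ hrel' h => simp [topSymbol, hrel'] at hrel
    | pop _ p _ r a _ _ hrel' h => simp_all [topSymbol]
  · rintro ⟨r, h, rfl⟩
    have := WOPA.Step.push (𝓐 := 𝓐) st q r b x k hrel h
    simpa [WOPA.pushWeight, dif_pos (show (q, b, r) ∈ 𝓐.push from h)] using this

theorem WOPA.setOf_step_shift {st : List (A × Q)} {p q : Q} {a b : A} {x : List A} {k : K}
    (hrel : M.rel (some a) (some b) = some OPRel.equal) :
    {C' | 𝓐.Step ⟨⟨(a, p) :: st, q, b :: x⟩, k⟩ C'} =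
      (fun r => ⟨⟨(b, p) :: st, r, x⟩, k * 𝓐.shiftWeight q b r⟩) ''
        {r | (q, b, r) ∈ 𝓐.shift} := by
  ext C'
  constructor
  · intro h
    cases h with
    | push _ _ r _ _ _ hrel' h => simp [topSymbol, hrel] at hrel'
    | shift _ _ _ r _ _ _ _ _ h => exact ⟨r, h, by simp [WOPA.shiftWeight, dif_pos h]⟩
    | pop _ _ _ r _ _ _ hrel' h => simp_all
  · rintro ⟨r, h, rfl⟩
    have := WOPA.Step.shift (𝓐 := 𝓐) st p q r a b x k hrel h
    simpa [WOPA.shiftWeight, dif_pos (show (q, b, r) ∈ 𝓐.shift from h)] using this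

theorem WOPA.setOf_step_pop {st : List (A × Q)} {p q : Q} {a : A} {x : List A} {k : K}
    (hrel : M.rel (some a) x.head? = some OPRel.takes) :
    {C' | 𝓐.Step ⟨⟨(a, p) :: st, q, x⟩, k⟩ C'} =
      (fun r => ⟨⟨st, r, x⟩, k * 𝓐.popWeight q p r⟩) '' {r | (q, p, r) ∈ 𝓐.pop} := by
  ext C'
  constructor
  · intro h
    cases h with
    | push _ _ r _ _ _ hrel' h => simp_all [topSymbol]
    | shift _ _ _ r _ _ _ _ hrel' h => simp_all
    | pop _ _ _ r _ _ _ _ h => exact ⟨r, h, by simp [WOPA.popWeight, dif_pos h]⟩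
  · rintro ⟨r, h, rfl⟩
    have := WOPA.Step.pop (𝓐 := 𝓐) st p q r a x k hrel h
    simpa [WOPA.popWeight, dif_pos (show (q, p, r) ∈ 𝓐.pop from h)] using this

theorem WOPA.Step.rel_ne_none {𝓐 : WOPA M K Q} {C C' : WOPConfig A K Q} (h : 𝓐.Step C C') :
    M.rel (topSymbol C.stack) C.input.head? ≠ none := by
  cases h <;> simp_all [topSymbol]

theorem WOPA.runsToFinal_of_final {q : Q} (hq : q ∈ 𝓐.final) (k : K) :
    𝓐.runsToFinal ⟨⟨[], q, []⟩, k⟩ = {[⟨⟨[], q, []⟩, k⟩]} := by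
  ext ρ
  constructor
  · rintro ⟨h₁, h₂, -⟩
    match ρ, h₁, h₂ with
    | [D], _, h₂ => simpa using h₂
    | D :: E :: t, h₁, h₂ =>
      obtain rfl : D = _ := by simpa using h₂
      exact absurd rfl (List.isChain_cons_cons.1 h₁).1.rel_ne_none
  · rintro rfl
    exact ⟨List.isChain_singleton _, rfl, q, hq, k, rfl⟩

/-- Moves multiply weights on the right, so the weight `k` accumulated so far factors out on the
left. The measure `2 * x.length + st.length` drops by one in a push or pop and by two in a shift, so
the recursion does not run out of steps. -/
theorem WOPA.finsum_runsToFinal_eq [Fintype Q] (n : ℕ) : ∀ (st : List (A × Q)) (q : Q)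
    (x : List A) (k : K), 2 * x.length + st.length < n →
    ∑ᶠ ρ ∈ 𝓐.runsToFinal ⟨⟨st, q, x⟩, k⟩, runWeight ρ = k * 𝓐.completionWeight n st q x := by
  induction n with
  | zero => intro st q x k h; omega
  | succ n ih =>
    intro st q x k hn
    rcases M.rel_cases st x with hrel | ⟨b, y, rfl, hrel⟩ | ⟨a, p, st, b, y, rfl, rfl, hrel⟩ |
      ⟨a, p, st, rfl, hrel⟩
    · rw [𝓐.completionWeight_none n hrel]
      by_cases hf : st = [] ∧ x = [] ∧ q ∈ 𝓐.final
      · obtain ⟨rfl, rfl, hq⟩ := hf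
        rw [𝓐.runsToFinal_of_final hq, finsum_mem_singleton]
        simp [runWeight, hq]
      · rw [if_neg hf, 𝓐.finsum_runsToFinal hf, mul_zero]
        refine finsum_mem_eq_zero_of_forall_eq_zero fun C' h => ?_
        exact absurd hrel (WOPA.Step.rel_ne_none h)
    · rw [𝓐.finsum_runsToFinal (by simp), 𝓐.completionWeight_yields n hrel, Finset.mul_sum]
      refine finsum_mem_image_eq_sum _ _ ?_ (𝓐.setOf_step_push hrel) _ _ ?_ ?_
      · intro r r' h
        simpa using congrArg (fun C => C.state) h
      · intro r _
        rw [ih _ _ _ _ (by simp at hn ⊢; omega), mul_assoc]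
      · intro r hr
        simp [WOPA.pushWeight, dif_neg (show (q, b, r) ∉ 𝓐.push from hr)]
    · rw [𝓐.finsum_runsToFinal (by simp), 𝓐.completionWeight_equal n hrel, Finset.mul_sum]
      refine finsum_mem_image_eq_sum _ _ ?_ (𝓐.setOf_step_shift hrel) _ _ ?_ ?_
      · intro r r' h
        simpa using congrArg (fun C => C.state) h
      · intro r _
        rw [ih _ _ _ _ (by simp at hn ⊢; omega), mul_assoc]
      · intro r hr
        simp [WOPA.shiftWeight, dif_neg (show (q, b, r) ∉ 𝓐.shift from hr)]
    · rw [𝓐.finsum_runsToFinal (by simp), 𝓐.completionWeight_takes n hrel, Finset.mul_sum]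
      refine finsum_mem_image_eq_sum _ _ ?_ (𝓐.setOf_step_pop hrel) _ _ ?_ ?_
      · intro r r' h
        simpa using congrArg (fun C => C.state) h
      · intro r _
        rw [ih _ _ _ _ (by simp at hn ⊢; omega), mul_assoc]
      · intro r hr
        simp [WOPA.popWeight, dif_neg (show (q, p, r) ∉ 𝓐.pop from hr)]

open Classical in
theorem WOPA.behavior_eq_sum [Fintype Q] (w : OPWord M) :
    𝓐.behavior w = ∑ q, if q ∈ 𝓐.init then
      𝓐.completionWeight (2 * w.1.length + 1) [] q w.1 else 0 := by
  have hU : 𝓐.acceptingRuns w.1 = ⋃ q ∈ 𝓐.init, 𝓐.runsToFinal ⟨⟨[], q, w.1⟩, 1⟩ := by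
    ext ρ
    simp only [Set.mem_iUnion, exists_prop]
    constructor
    · rintro ⟨h₁, ⟨q, hq, h₂⟩, h₃⟩
      exact ⟨q, hq, h₁, h₂, h₃⟩
    · rintro ⟨q, hq, h₁, h₂, h₃⟩
      exact ⟨h₁, ⟨q, hq, h₂⟩, h₃⟩
  rw [WOPA.behavior, ← finsum_mem_eq_finite_toFinset_sum, hU, finsum_mem_biUnion]
  · rw [← finsum_eq_sum_of_fintype]
    refine finsum_congr fun q => ?_
    by_cases hq : q ∈ 𝓐.init
    · simp only [hq, finsum_true, if_true]
      rw [𝓐.finsum_runsToFinal_eq (2 * w.1.length + 1) _ _ _ _ (by simp), one_mul]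
    · simp [hq]
  · rintro q - q' - hne
    refine Set.disjoint_left.2 fun ρ h₁ h₂ => hne ?_
    simpa using congrArg (fun C => C.state)
      (Option.some_injective _ (h₁.2.1.symm.trans h₂.2.1))
  · exact Set.toFinite _
  · exact fun q _ => 𝓐.finite_runsToFinal _

end Runs

/-! ### Products of automata -/

/-- All weights commute with every element of the semiring. -/
def WOPA.Central {A K Q : Type*} [Semiring K] {M : OPM A} (𝓐 : WOPA M K Q) : Prop :=
  (∀ t, 𝓐.wtPush t ∈ Subsemiring.center K) ∧ (∀ t, 𝓐.wtShift t ∈ Subsemiring.center K) ∧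
    ∀ t, 𝓐.wtPop t ∈ Subsemiring.center K

section Central

variable {A K Q : Type*} [Semiring K] {M : OPM A} {𝓐 : WOPA M K Q}

theorem WOPA.Central.pushWeight_mem (h𝓐 : 𝓐.Central) (q : Q) (b : A) (r : Q) :
    𝓐.pushWeight q b r ∈ Subsemiring.center K := by
  unfold WOPA.pushWeight
  split_ifs
  exacts [h𝓐.1 _, zero_mem _]

theorem WOPA.Central.shiftWeight_mem (h𝓐 : 𝓐.Central) (q : Q) (b : A) (r : Q) :
    𝓐.shiftWeight q b r ∈ Subsemiring.center K := by
  unfold WOPA.shiftWeight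
  split_ifs
  exacts [h𝓐.2.1 _, zero_mem _]

theorem WOPA.Central.popWeight_mem (h𝓐 : 𝓐.Central) (q p r : Q) :
    𝓐.popWeight q p r ∈ Subsemiring.center K := by
  unfold WOPA.popWeight
  split_ifs
  exacts [h𝓐.2.2 _, zero_mem _]

end Central

/-- The product automaton, whose runs are the pairs of runs of the factors. -/
def WOPA.prod {A K Q R : Type*} [Semiring K] {M : OPM A} (𝓐 : WOPA M K Q) (𝓑 : WOPA M K R) :
    WOPA M K (Q × R) where
  init := 𝓐.init ×ˢ 𝓑.init
  final := 𝓐.final ×ˢ 𝓑.final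
  shift := {t | (t.1.1, t.2.1, t.2.2.1) ∈ 𝓐.shift ∧ (t.1.2, t.2.1, t.2.2.2) ∈ 𝓑.shift}
  push := {t | (t.1.1, t.2.1, t.2.2.1) ∈ 𝓐.push ∧ (t.1.2, t.2.1, t.2.2.2) ∈ 𝓑.push}
  pop := {t | (t.1.1, t.2.1.1, t.2.2.1) ∈ 𝓐.pop ∧ (t.1.2, t.2.1.2, t.2.2.2) ∈ 𝓑.pop}
  wtShift t := 𝓐.wtShift ⟨_, t.2.1⟩ * 𝓑.wtShift ⟨_, t.2.2⟩
  wtPush t := 𝓐.wtPush ⟨_, t.2.1⟩ * 𝓑.wtPush ⟨_, t.2.2⟩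
  wtPop t := 𝓐.wtPop ⟨_, t.2.1⟩ * 𝓑.wtPop ⟨_, t.2.2⟩

section Prod

variable {A K Q R : Type*} [Semiring K] {M : OPM A} {𝓐 : WOPA M K Q} {𝓑 : WOPA M K R}

theorem WOPA.prod_pushWeight (q : Q × R) (b : A) (r : Q × R) :
    (𝓐.prod 𝓑).pushWeight q b r = 𝓐.pushWeight q.1 b r.1 * 𝓑.pushWeight q.2 b r.2 := by
  by_cases h : (q.1, b, r.1) ∈ 𝓐.push <;> by_cases h' : (q.2, b, r.2) ∈ 𝓑.push <;>
    simp [WOPA.pushWeight, WOPA.prod, h, h']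

theorem WOPA.prod_shiftWeight (q : Q × R) (b : A) (r : Q × R) :
    (𝓐.prod 𝓑).shiftWeight q b r = 𝓐.shiftWeight q.1 b r.1 * 𝓑.shiftWeight q.2 b r.2 := by
  by_cases h : (q.1, b, r.1) ∈ 𝓐.shift <;> by_cases h' : (q.2, b, r.2) ∈ 𝓑.shift <;>
    simp [WOPA.shiftWeight, WOPA.prod, h, h']

theorem WOPA.prod_popWeight (q p r : Q × R) :
    (𝓐.prod 𝓑).popWeight q p r = 𝓐.popWeight q.1 p.1 r.1 * 𝓑.popWeight q.2 p.2 r.2 := by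
  by_cases h : (q.1, p.1, r.1) ∈ 𝓐.pop <;> by_cases h' : (q.2, p.2, r.2) ∈ 𝓑.pop <;>
    simp [WOPA.popWeight, WOPA.prod, h, h']

theorem WOPA.Restricted.prod (h𝓐 : 𝓐.Restricted) (h𝓑 : 𝓑.Restricted) :
    (𝓐.prod 𝓑).Restricted := fun t => by
  simp [WOPA.prod, h𝓐 ⟨_, t.2.1⟩, h𝓑 ⟨_, t.2.2⟩]

/-- The only place where commutation is needed: the weight `b r` of a move of the second factor has
to pass the weight `x q` of the rest of the first run. -/
theorem sum_prod_mul_of_central [Fintype Q] [Fintype R] (a x : Q → K) (b y : R → K)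
    (hb : ∀ r, b r ∈ Subsemiring.center K) :
    ∑ s : Q × R, a s.1 * b s.2 * (x s.1 * y s.2) = (∑ q, a q * x q) * ∑ r, b r * y r := by
  rw [Finset.sum_mul_sum, Fintype.sum_prod_type]
  refine Finset.sum_congr rfl fun q _ => Finset.sum_congr rfl fun r _ => ?_
  have h := Subsemiring.mem_center_iff.1 (hb r) (x q)
  rw [mul_assoc, ← mul_assoc (b r), ← h, mul_assoc, mul_assoc]

theorem topSymbol_map (f : Q → R) (st : List (A × Q)) :
    topSymbol (st.map (Prod.map id f)) = topSymbol st := by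
  cases st <;> rfl

/-- Projecting the states keeps the stack symbols, so all three recursions take the same branch. -/
theorem WOPA.completionWeight_prod [Fintype Q] [Fintype R] (h𝓑 : 𝓑.Central) (n : ℕ) :
    ∀ (st : List (A × (Q × R))) (q : Q × R) (x : List A),
      (𝓐.prod 𝓑).completionWeight n st q x =
        𝓐.completionWeight n (st.map (Prod.map id Prod.fst)) q.1 x *
          𝓑.completionWeight n (st.map (Prod.map id Prod.snd)) q.2 x := by
  induction n with
  | zero => intro st q x; simp [WOPA.completionWeight]
  | succ n ih =>
    intro st q x
    rcases M.rel_cases st x with hrel | ⟨b, y, rfl, hrel⟩ | ⟨a, p, st, b, y, rfl, rfl, hrel⟩ |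
      ⟨a, p, st, rfl, hrel⟩
    · rw [WOPA.completionWeight_none _ n hrel,
        WOPA.completionWeight_none _ n (by rwa [topSymbol_map]),
        WOPA.completionWeight_none _ n (by rwa [topSymbol_map])]
      by_cases h : st = [] ∧ x = []
      · by_cases h₁ : q.1 ∈ 𝓐.final <;> by_cases h₂ : q.2 ∈ 𝓑.final <;>
          simp [h, h₁, h₂, WOPA.prod]
      · rw [if_neg (by tauto), if_neg (by simp; tauto), zero_mul]
    · rw [WOPA.completionWeight_yields _ n hrel,
        WOPA.completionWeight_yields _ n (by rwa [topSymbol_map]),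
        WOPA.completionWeight_yields _ n (by rwa [topSymbol_map]),
        ← sum_prod_mul_of_central _ _ _ _ fun r => h𝓑.pushWeight_mem _ _ r]
      refine Finset.sum_congr rfl fun r _ => ?_
      rw [WOPA.prod_pushWeight, ih]
      rfl
    · simp only [List.map_cons, Prod.map_apply, id_eq]
      rw [WOPA.completionWeight_equal _ n hrel, WOPA.completionWeight_equal _ n hrel,
        WOPA.completionWeight_equal _ n hrel,
        ← sum_prod_mul_of_central _ _ _ _ fun r => h𝓑.shiftWeight_mem _ _ r]
      refine Finset.sum_congr rfl fun r _ => ?_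
      rw [WOPA.prod_shiftWeight, ih]
      rfl
    · simp only [List.map_cons, Prod.map_apply, id_eq]
      rw [WOPA.completionWeight_takes _ n hrel, WOPA.completionWeight_takes _ n hrel,
        WOPA.completionWeight_takes _ n hrel,
        ← sum_prod_mul_of_central _ _ _ _ fun r => h𝓑.popWeight_mem _ _ r]
      refine Finset.sum_congr rfl fun r _ => ?_
      rw [WOPA.prod_popWeight, ih]

theorem WOPA.behavior_prod [Finite Q] [Finite R] (h𝓑 : 𝓑.Central) :
    (𝓐.prod 𝓑).behavior = seriesProd 𝓐.behavior 𝓑.behavior := by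
  classical
  have := Fintype.ofFinite Q
  have := Fintype.ofFinite R
  funext w
  rw [seriesProd, WOPA.behavior_eq_sum, WOPA.behavior_eq_sum, WOPA.behavior_eq_sum,
    Finset.sum_mul_sum, Fintype.sum_prod_type]
  refine Finset.sum_congr rfl fun q _ => Finset.sum_congr rfl fun r _ => ?_
  rw [WOPA.completionWeight_prod h𝓑]
  by_cases hq : q ∈ 𝓐.init <;> by_cases hr : r ∈ 𝓑.init <;> simp [WOPA.prod, hq, hr]

end Prod

/-! ### Determinization -/

/-- The deterministic automaton equivalent to a given one, with all weights `1`. Its states are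
sets of pairs of a state that the given automaton may have reached and the state stored
in the topmost stack element (`none` for the stack `⊥`). -/
def OPA.determinize {A Q : Type*} {M : OPM A} (𝓐 : OPA M Q) (K : Type*) [Semiring K] :
    WOPA M K (Set (Q × Option Q)) where
  init := {{s | s.1 ∈ 𝓐.init ∧ s.2 = none}}
  final := {X | ∃ q ∈ 𝓐.final, (q, none) ∈ X}
  shift := {t | t.2.2 = {s | ∃ q, (q, s.2) ∈ t.1 ∧ (q, t.2.1, s.1) ∈ 𝓐.shift}}
  push := {t | t.2.2 = {s | ∃ q p, (q, p) ∈ t.1 ∧ s.2 = some q ∧ (q, t.2.1, s.1) ∈ 𝓐.push}}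
  pop := {t | t.2.2 = {s | ∃ q p, (q, some p) ∈ t.1 ∧ (p, s.2) ∈ t.2.1 ∧ (q, p, s.1) ∈ 𝓐.pop}}
  wtShift _ := 1
  wtPush _ := 1
  wtPop _ := 1

/-- The pairs of a stack and a state that are represented by a stack and a state of the
deterministic automaton. -/
def Represents {A Q : Type*} :
    List (A × Set (Q × Option Q)) → Set (Q × Option Q) → List (A × Q) → Q → Prop
  | [], X, st, q => st = [] ∧ (q, none) ∈ X
  | (a, Y) :: dst, X, st, q =>
    ∃ p st', st = (a, p) :: st' ∧ (q, some p) ∈ X ∧ Represents dst Y st' p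

section Determinize

variable {A Q : Type*} {M : OPM A} (𝓐 : OPA M Q)

theorem Represents.topSymbol_eq {dst : List (A × Set (Q × Option Q))} {X : Set (Q × Option Q)}
    {st : List (A × Q)} {q : Q} (h : Represents dst X st q) : topSymbol st = topSymbol dst := by
  rcases dst with _ | ⟨⟨a, Y⟩, dst⟩
  · rw [h.1]; rfl
  · obtain ⟨p, st', rfl, -⟩ := h
    rfl

/-- Some represented configuration leads to acceptance. -/
def OPA.AcceptsRep (dst : List (A × Set (Q × Option Q))) (X : Set (Q × Option Q)) (x : List A) :
    Prop :=
  ∃ st q, Represents dst X st q ∧ ∃ q' ∈ 𝓐.final,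
    Relation.ReflTransGen 𝓐.Step ⟨st, q, x⟩ ⟨[], q', []⟩

/-- The current state and the stack constrain each other only through the state `o` stored on top.
With `Represents.change_state`, this allows the current state to be exchanged while the stack is
kept, as a pop requires. -/
theorem represents_exists_top {dst : List (A × Set (Q × Option Q))} {X : Set (Q × Option Q)}
    {st : List (A × Q)} {q : Q} :
    Represents dst X st q ↔ ∃ o, (q, o) ∈ X ∧ Represents dst {s | s.2 = o} st q := by
  rcases dst with _ | ⟨⟨a, Y⟩, dst⟩
  · simp [Represents]
    tauto
  · constructor
    · rintro ⟨p, st', h₁, h₂, h₃⟩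
      exact ⟨some p, h₂, p, st', h₁, rfl, h₃⟩
    · rintro ⟨o, ho, p, st', h₁, h₂, h₃⟩
      obtain rfl : some p = o := h₂
      exact ⟨p, st', h₁, ho, h₃⟩

theorem Represents.change_state {dst : List (A × Set (Q × Option Q))} {o : Option Q}
    {st : List (A × Q)} {q : Q} (r : Q) (h : Represents dst {s | s.2 = o} st q) :
    Represents dst {s | s.2 = o} st r := by
  rcases dst with _ | ⟨⟨a, Y⟩, dst⟩
  · exact h
  · exact h

theorem OPA.Step.rel_ne_none {𝓐 : OPA M Q} {C C' : OPConfig A Q} (h : 𝓐.Step C C') :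
    M.rel (topSymbol C.stack) C.input.head? ≠ none := by
  cases h <;> simp_all [topSymbol]

variable {𝓐} {dst : List (A × Set (Q × Option Q))} {X : Set (Q × Option Q)} {x : List A}

theorem OPA.acceptsRep_none (hrel : M.rel (topSymbol dst) x.head? = none) :
    𝓐.AcceptsRep dst X x ↔ dst = [] ∧ x = [] ∧ ∃ q ∈ 𝓐.final, (q, none) ∈ X := by
  constructor
  · rintro ⟨st, q, hrep, q', hq', hrun⟩
    rcases Relation.ReflTransGen.cases_head_iff.1 hrun with h | ⟨C, hs, -⟩
    · obtain ⟨rfl, rfl, rfl⟩ : st = [] ∧ q = q' ∧ x = [] := by simpa using h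
      rcases dst with _ | ⟨⟨a, Y⟩, dst⟩
      · exact ⟨rfl, rfl, q, hq', hrep.2⟩
      · obtain ⟨p, st', h, -⟩ := hrep
        simp at h
    · exact absurd (hrep.topSymbol_eq ▸ hrel) hs.rel_ne_none
  · rintro ⟨rfl, rfl, q, hq, hX⟩
    exact ⟨[], q, ⟨rfl, hX⟩, q, hq, Relation.ReflTransGen.refl⟩

theorem OPA.acceptsRep_yields {b : A}
    (hrel : M.rel (topSymbol dst) (some b) = some OPRel.yields) :
    𝓐.AcceptsRep dst X (b :: x) ↔ 𝓐.AcceptsRep ((b, X) :: dst)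
      {s | ∃ q p, (q, p) ∈ X ∧ s.2 = some q ∧ (q, b, s.1) ∈ 𝓐.push} x := by
  constructor
  · rintro ⟨st, q, hrep, q', hq', hrun⟩
    rw [← hrep.topSymbol_eq] at hrel
    rcases Relation.ReflTransGen.cases_head_iff.1 hrun with h | ⟨C, hs, hrun⟩
    · simp at h
    · cases hs with
      | push _ _ r _ _ _ h =>
        obtain ⟨o, ho, -⟩ := represents_exists_top.1 hrep
        exact ⟨_, r, ⟨q, st, rfl, ⟨q, o, ho, rfl, h⟩, hrep⟩, q', hq', hrun⟩
      | shift _ p _ r a _ _ hrel' h => simp [topSymbol, hrel'] at hrel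
      | pop _ p _ r a _ hrel' h => simp_all [topSymbol]
  · rintro ⟨st, r, ⟨q, st', rfl, ⟨q₁, o, -, hqq, h⟩, hrep⟩, q', hq', hrun⟩
    obtain rfl : q = q₁ := by simpa using hqq
    rw [← hrep.topSymbol_eq] at hrel
    exact ⟨st', q, hrep, q', hq', Relation.ReflTransGen.head (.push _ _ _ _ _ hrel h) hrun⟩

theorem OPA.acceptsRep_equal {a b : A} {Y : Set (Q × Option Q)}
    (hrel : M.rel (some a) (some b) = some OPRel.equal) :
    𝓐.AcceptsRep ((a, Y) :: dst) X (b :: x) ↔ 𝓐.AcceptsRep ((b, Y) :: dst)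
      {s | ∃ q, (q, s.2) ∈ X ∧ (q, b, s.1) ∈ 𝓐.shift} x := by
  constructor
  · rintro ⟨st, q, ⟨p, st, rfl, hX, hrep⟩, q', hq', hrun⟩
    rcases Relation.ReflTransGen.cases_head_iff.1 hrun with h | ⟨C, hs, hrun⟩
    · simp at h
    · cases hs with
      | push _ _ r _ _ hrel' h => simp [topSymbol, hrel] at hrel'
      | shift _ _ _ r _ _ _ _ h =>
        exact ⟨_, r, ⟨p, st, rfl, ⟨q, hX, h⟩, hrep⟩, q', hq', hrun⟩
      | pop _ _ _ r _ _ hrel' h => simp_all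
  · rintro ⟨st, r, ⟨p, st, rfl, ⟨q, hX, h⟩, hrep⟩, q', hq', hrun⟩
    exact ⟨_, q, ⟨p, st, rfl, hX, hrep⟩, q', hq',
      Relation.ReflTransGen.head (.shift _ _ _ _ _ _ _ hrel h) hrun⟩

/-- `Y` is the set that was current just before the push, so a pair `(p, o)` in `Y` joins the stored
state `p` to the state `o` stored one level below. Matching `p` in `X` and `Y` fits the popped move
to the right lower stack and recovers its top. -/
theorem OPA.acceptsRep_takes {a : A} {Y : Set (Q × Option Q)}
    (hrel : M.rel (some a) x.head? = some OPRel.takes) :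
    𝓐.AcceptsRep ((a, Y) :: dst) X x ↔ 𝓐.AcceptsRep dst
      {s | ∃ q p, (q, some p) ∈ X ∧ (p, s.2) ∈ Y ∧ (q, p, s.1) ∈ 𝓐.pop} x := by
  constructor
  · rintro ⟨st, q, ⟨p, st, rfl, hX, hrep⟩, q', hq', hrun⟩
    rcases Relation.ReflTransGen.cases_head_iff.1 hrun with h | ⟨C, hs, hrun⟩
    · simp at h
    · cases hs with
      | push _ _ r _ _ hrel' h => simp_all [topSymbol]
      | shift _ _ _ r _ _ _ hrel' h => simp_all
      | pop _ _ _ r _ _ _ h =>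
        obtain ⟨o, ho, htop⟩ := represents_exists_top.1 hrep
        exact ⟨st, r, represents_exists_top.2 ⟨o, ⟨q, p, hX, ho, h⟩, htop.change_state r⟩,
          q', hq', hrun⟩
  · rintro ⟨st, r, hrep, q', hq', hrun⟩
    obtain ⟨o, ⟨q, p, hX, ho, h⟩, htop⟩ := represents_exists_top.1 hrep
    exact ⟨_, q, ⟨p, st, rfl, hX, represents_exists_top.2 ⟨o, ho, htop.change_state p⟩⟩, q', hq',
      Relation.ReflTransGen.head (.pop _ _ _ _ _ _ hrel h) hrun⟩

variable {K : Type*} [Semiring K]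

open Classical in
theorem OPA.determinize_pushWeight (X : Set (Q × Option Q)) (b : A) (Z : Set (Q × Option Q)) :
    (𝓐.determinize K).pushWeight X b Z =
      if Z = {s | ∃ q p, (q, p) ∈ X ∧ s.2 = some q ∧ (q, b, s.1) ∈ 𝓐.push} then 1 else 0 := rfl

open Classical in
theorem OPA.determinize_shiftWeight (X : Set (Q × Option Q)) (b : A) (Z : Set (Q × Option Q)) :
    (𝓐.determinize K).shiftWeight X b Z =
      if Z = {s | ∃ q, (q, s.2) ∈ X ∧ (q, b, s.1) ∈ 𝓐.shift} then 1 else 0 := rfl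

open Classical in
theorem OPA.determinize_popWeight (X Y Z : Set (Q × Option Q)) :
    (𝓐.determinize K).popWeight X Y Z =
      if Z = {s | ∃ q p, (q, some p) ∈ X ∧ (p, s.2) ∈ Y ∧ (q, p, s.1) ∈ 𝓐.pop} then 1 else 0 := rfl

-- Each triple of source data has exactly one target set, so every sum over targets collapses to one
-- term, and acceptance from some represented configuration is equivalent before and after that
-- move.
open Classical in
theorem OPA.determinize_completionWeight [Fintype (Set (Q × Option Q))] (n : ℕ) :
    ∀ (dst : List (A × Set (Q × Option Q))) (X : Set (Q × Option Q)) (x : List A),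
      2 * x.length + dst.length < n →
      (𝓐.determinize K).completionWeight n dst X x = if 𝓐.AcceptsRep dst X x then 1 else 0 := by
  induction n with
  | zero => intro dst X x h; omega
  | succ n ih =>
    intro dst X x hn
    rcases M.rel_cases dst x with hrel | ⟨b, y, rfl, hrel⟩ | ⟨a, Y, dst, b, y, rfl, rfl, hrel⟩ |
      ⟨a, Y, dst, rfl, hrel⟩
    · rw [WOPA.completionWeight_none _ n hrel, if_congr (OPA.acceptsRep_none hrel) rfl rfl]
      rfl
    · rw [WOPA.completionWeight_yields _ n hrel, if_congr (OPA.acceptsRep_yields hrel) rfl rfl,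
        ← ih _ _ _ (by simp at hn ⊢; omega)]
      simp only [OPA.determinize_pushWeight, ite_mul, one_mul, zero_mul, Finset.sum_ite_eq',
        Finset.mem_univ, if_true]
    · rw [WOPA.completionWeight_equal _ n hrel, if_congr (OPA.acceptsRep_equal hrel) rfl rfl,
        ← ih _ _ _ (by simp at hn ⊢; omega)]
      simp only [OPA.determinize_shiftWeight, ite_mul, one_mul, zero_mul, Finset.sum_ite_eq',
        Finset.mem_univ, if_true]
    · rw [WOPA.completionWeight_takes _ n hrel, if_congr (OPA.acceptsRep_takes hrel) rfl rfl,
        ← ih _ _ _ (by simp at hn ⊢; omega)]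
      simp only [OPA.determinize_popWeight, ite_mul, one_mul, zero_mul, Finset.sum_ite_eq',
        Finset.mem_univ, if_true]

/-- With an empty stack, the initial set represents exactly the initial configurations on `w`. -/
theorem OPA.mem_language_iff (w : OPWord M) :
    w ∈ 𝓐.language ↔ 𝓐.AcceptsRep [] {s | s.1 ∈ 𝓐.init ∧ s.2 = none} w.1 := by
  constructor
  · rintro ⟨ρ, h₁, ⟨q, hq, h₂⟩, q', hq', h₃⟩
    match ρ, h₁, h₂, h₃ with
    | C :: t, h₁, h₂, h₃ =>
      obtain rfl : C = _ := by simpa using h₂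
      refine ⟨[], q, ⟨rfl, hq, rfl⟩, q', hq',
        List.relationReflTransGen_of_exists_isChain_cons t h₁ ?_⟩
      rw [List.getLast?_eq_getLast_of_ne_nil (by simp)] at h₃
      simpa using h₃
  · rintro ⟨st, q, ⟨rfl, hq, -⟩, q', hq', hrun⟩
    obtain ⟨t, h₁, h₃⟩ := List.exists_isChain_cons_of_relationReflTransGen hrun
    refine ⟨_ :: t, h₁, ⟨q, hq, rfl⟩, q', hq', ?_⟩
    rw [List.getLast?_eq_getLast_of_ne_nil (by simp), h₃]

open Classical in
theorem OPA.determinize_behavior [Finite Q] (w : OPWord M) :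
    (𝓐.determinize K).behavior w = if w ∈ 𝓐.language then 1 else 0 := by
  have := Fintype.ofFinite (Set (Q × Option Q))
  rw [WOPA.behavior_eq_sum, if_congr (OPA.mem_language_iff w) rfl rfl,
    ← OPA.determinize_completionWeight (2 * w.1.length + 1) _ _ _ (by simp)]
  simp only [OPA.determinize, Set.mem_singleton_iff, Finset.sum_ite_eq', Finset.mem_univ, if_true]

theorem OPA.determinize_restricted : (𝓐.determinize K).Restricted := fun _ => rfl

theorem OPA.determinize_central : (𝓐.determinize K).Central :=
  ⟨fun _ => one_mem _, fun _ => one_mem _, fun _ => one_mem _⟩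

theorem OPA.behavior_prod_determinize {R : Type*} [Finite R] [Finite Q] (𝓑 : WOPA M K R) :
    (𝓑.prod (𝓐.determinize K)).behavior = seriesRestrict 𝓑.behavior 𝓐.language := by
  rw [WOPA.behavior_prod OPA.determinize_central]
  funext w
  rw [seriesProd, OPA.determinize_behavior, seriesRestrict, mul_ite, mul_one, mul_zero]

end Determinize

/-! ### The closure properties -/

theorem WOPA.central_of_comm {A K Q : Type*} [Semiring K] {M : OPM A}
    (hK : ∀ x y : K, x * y = y * x) (𝓐 : WOPA M K Q) : 𝓐.Central := by
  have h : ∀ x : K, x ∈ Subsemiring.center K := fun x => Subsemiring.mem_center_iff.2 (hK · x)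
  exact ⟨fun _ => h _, fun _ => h _, fun _ => h _⟩

theorem mainTheorem7 {A : Type*} (M : OPM A) (K : Type*) [Semiring K] :
    (∀ (S : OPWord M → K) (L : Set (OPWord M)), IsOPL L →
      (IsRegularSeries S → IsRegularSeries (seriesRestrict S L)) ∧
      (IsStrictlyRegularSeries S → IsStrictlyRegularSeries (seriesRestrict S L))) ∧
    ((∀ x y : K, x * y = y * x) → ∀ S T : OPWord M → K,
      (IsRegularSeries S → IsRegularSeries T → IsRegularSeries (seriesProd S T)) ∧
      (IsStrictlyRegularSeries S → IsStrictlyRegularSeries T →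
        IsStrictlyRegularSeries (seriesProd S T))) := by
  refine ⟨?_, fun hK S T => ⟨?_, ?_⟩⟩
  · rintro S L ⟨R, _, 𝓓, rfl⟩
    constructor
    · rintro ⟨Q, _, 𝓐, rfl⟩
      exact ⟨_, inferInstance, 𝓐.prod (𝓓.determinize K), OPA.behavior_prod_determinize 𝓐⟩
    · rintro ⟨Q, _, 𝓐, h𝓐, rfl⟩
      exact ⟨_, inferInstance, 𝓐.prod (𝓓.determinize K), h𝓐.prod OPA.determinize_restricted,
        OPA.behavior_prod_determinize 𝓐⟩
  · rintro ⟨Q, _, 𝓐, rfl⟩ ⟨R, _, 𝓑, rfl⟩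
    exact ⟨_, inferInstance, 𝓐.prod 𝓑, WOPA.behavior_prod (𝓑.central_of_comm hK)⟩
  · rintro ⟨Q, _, 𝓐, h𝓐, rfl⟩ ⟨R, _, 𝓑, h𝓑, rfl⟩
    exact ⟨_, inferInstance, 𝓐.prod 𝓑, h𝓐.prod h𝓑, WOPA.behavior_prod (𝓑.central_of_comm hK)⟩
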